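/- Let $H$ be a separable complex Hilbert space. For a unital algebra $\mathcal A$ of bounded operators on $H$ let $\mathcal L=\mathrm{Lat}\,\mathcal A$ be the lattice of orthogonal projections onto closed $\mathcal A$-invariant subspaces, ordered by $L_1\le L_2\iff L_1L_2=L_1$. Let $M(\mathcal L)$ be the partially ordered set of all meet-irreducible elements of $\mathcal L$ other than the identity $I$ (those $M\neq I$ in $\mathcal L$ such that $E\wedge F=M$ with $E,F\in\mathcal L$ implies $E=M$ or $F=M$), with the topology generated by the sets $[L,I)=\{M\in M(\mathcal L): L\le M\}$ and their complements, where $L$ ranges over $\mathcal L$. A pair $(x,y)$ of points of $M(\mathcal L)$ is a topological edge if there are neighbourhoods $U_x$ of $x$ and $U_y$ of $y$ with $s\le t$ for all $s\in U_x$, $t\in U_y$. For a finite subset $F\subseteq M(\mathcal L)$ let $\Delta(F)$ be the simplicial complex with vertex set $F$ whose simplices are the nonempty subsets of $F$ any two distinct elements $x,y$ of which satisfy that $(x,y)$ or $(y,x)$ is a topological edge. The spectral homology groups of $\mathcal A$ are the direct limits $$H_t^{sp}(\mathcal A)=\varinjlim_{F} H_t(\Delta(F)),\qquad t=0,1,2,\dots,$$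 of integral simplicial homology groups, taken over the finite subsets $F$ of $M(\mathcal L)$ directed by inclusion. A nest is a totally ordered family of closed subspaces of $H$ which contains $0$ and $H$ and is closed under arbitrary intersections and closed linear spans; a nest algebra is the algebra of all bounded operators on $H$ that leave every member of some nest invariant. **Proposition 3.4.** If $\mathcal A$ is a nest algebra, then $H_t^{sp}(\mathcal A)=0$ for all $t>0$. -/

import Mathlib

open scoped Topology

/-! ## Oriented simplicial homology with integer coefficients -/

namespace SimplicialHomology

variable {V : Type*}

/-- Tuples `(v₀, …, vₙ)` of vertices (repetitions allowed) whose set of entries is a simplex of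
the abstract simplicial complex `K`. -/
def Tuple (K : PreAbstractSimplicialComplex V) (n : ℕ) : Type _ :=
  {x : Fin (n + 1) → V // ∃ s ∈ K, (s : Set V) = Set.range x}

theorem exists_face_comp {K : PreAbstractSimplicialComplex V} {m n : ℕ} (x : Tuple K n)
    (f : Fin (m + 1) → Fin (n + 1)) : ∃ s ∈ K, (s : Set V) = Set.range (x.1 ∘ f) := by
  classical
  obtain ⟨s, hs, hsx⟩ := x.2
  refine ⟨Finset.univ.image (x.1 ∘ f), ?_, by rw [Finset.coe_image, Finset.coe_univ, Set.image_univ]⟩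
  refine (K.isRelLowerSet_faces hs).2 ?_ (Finset.univ_nonempty.image _)
  intro v hv
  obtain ⟨i, -, rfl⟩ := Finset.mem_image.1 hv
  exact Finset.mem_coe.1 (hsx ▸ Set.mem_range_self (f i))

/-- Reindexing of a tuple: `(v_{f 0}, …, v_{f m})`. -/
def Tuple.comp {K : PreAbstractSimplicialComplex V} {m n : ℕ} (x : Tuple K n)
    (f : Fin (m + 1) → Fin (n + 1)) : Tuple K m :=
  ⟨x.1 ∘ f, exists_face_comp x f⟩

/-- The relations between oriented simplices: a permutation of the vertices multiplies the
oriented simplex by the sign of the permutation, and a tuple with a repeated vertex is zero. -/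
noncomputable def orientationRelations (K : PreAbstractSimplicialComplex V) (n : ℕ) :
    Submodule ℤ (Tuple K n →₀ ℤ) :=
  Submodule.span ℤ
    ({c | ∃ (x : Tuple K n) (σ : Equiv.Perm (Fin (n + 1))),
        c = Finsupp.single (x.comp σ) 1 - Finsupp.single x (Equiv.Perm.sign σ : ℤ)} ∪
      {c | ∃ x : Tuple K n, ¬ Function.Injective x.1 ∧ c = Finsupp.single x 1})

theorem orientationRelations_le {K : PreAbstractSimplicialComplex V} {n : ℕ}
    {P : Submodule ℤ (Tuple K n →₀ ℤ)}
    (h₁ : ∀ (x : Tuple K n) (σ : Equiv.Perm (Fin (n + 1))),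
      Finsupp.single (x.comp σ) 1 - Finsupp.single x (Equiv.Perm.sign σ : ℤ) ∈ P)
    (h₂ : ∀ x : Tuple K n, ¬ Function.Injective x.1 → Finsupp.single x 1 ∈ P) :
    orientationRelations K n ≤ P := by
  refine Submodule.span_le.2 ?_
  rintro c (⟨x, σ, rfl⟩ | ⟨x, hx, rfl⟩)
  · exact h₁ x σ
  · exact h₂ x hx

/-- The group `Cₙ(K)` of oriented simplicial `n`-chains of `K`. -/
abbrev Chains (K : PreAbstractSimplicialComplex V) (n : ℕ) : Type _ :=
  (Tuple K n →₀ ℤ) ⧸ orientationRelations K n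

/-- The oriented simplex `[v₀, …, vₙ]`. -/
noncomputable def oriented {K : PreAbstractSimplicialComplex V} {n : ℕ} (x : Tuple K n) : Chains K n :=
  (orientationRelations K n).mkQ (Finsupp.single x 1)

theorem oriented_comp_perm {K : PreAbstractSimplicialComplex V} {n : ℕ} (x : Tuple K n)
    (σ : Equiv.Perm (Fin (n + 1))) :
    oriented (x.comp σ) = (Equiv.Perm.sign σ : ℤ) • oriented x := by
  rw [oriented, oriented, ← map_smul, ← sub_eq_zero, ← map_sub, Submodule.mkQ_apply,
    Submodule.Quotient.mk_eq_zero]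
  refine Submodule.subset_span (Or.inl ⟨x, σ, ?_⟩)
  rw [Finsupp.smul_single, smul_eq_mul, mul_one]

theorem oriented_of_not_injective {K : PreAbstractSimplicialComplex V} {n : ℕ} (x : Tuple K n)
    (hx : ¬ Function.Injective x.1) : oriented x = 0 := by
  rw [oriented, Submodule.mkQ_apply, Submodule.Quotient.mk_eq_zero]
  exact Submodule.subset_span (Or.inr ⟨x, hx, rfl⟩)

/-- `∑ i, (-1)^i [v₀, …, v̂ᵢ, …, vₙ₊₁]`. -/
noncomputable def alternatingFaces {K : PreAbstractSimplicialComplex V} {n : ℕ} (x : Tuple K (n + 1)) :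
    Chains K n :=
  ∑ i : Fin (n + 2), ((-1 : ℤ) ^ (i : ℕ)) • oriented (x.comp i.succAbove)

theorem swap_comp_succAbove {n : ℕ} (i : Fin (n + 2)) (a b : Fin (n + 1)) :
    Equiv.swap (i.succAbove a) (i.succAbove b) ∘ i.succAbove
      = i.succAbove ∘ Equiv.swap a b := by
  funext k
  simp only [Function.comp_apply, Equiv.swap_apply_def, Fin.succAbove_right_inj]
  split_ifs <;> rfl

theorem swap_comp_castSucc {n : ℕ} (j : Fin (n + 1)) :
    Equiv.swap j.castSucc j.succ ∘ j.castSucc.succAbove = j.succ.succAbove := by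
  funext k
  simp only [Function.comp_apply, Equiv.swap_apply_def, Fin.ext_iff, Fin.succAbove, Fin.lt_def]
  split_ifs <;> simp_all <;> omega

theorem alternatingFaces_swap {K : PreAbstractSimplicialComplex V} {n : ℕ}
    (x : Tuple K (n + 1)) (j : Fin (n + 1)) :
    alternatingFaces (x.comp (Equiv.swap j.castSucc j.succ)) = - alternatingFaces x := by
  have hne : j.castSucc ≠ j.succ := Fin.castSucc_lt_succ.ne
  have hcomp : ∀ i : Fin (n + 2),
      (x.comp (Equiv.swap j.castSucc j.succ)).comp i.succAbove
        = x.comp (Equiv.swap j.castSucc j.succ ∘ i.succAbove) := fun i => rfl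
  have key : ∀ i : Fin (n + 2),
      ((-1 : ℤ) ^ (i : ℕ)) • oriented ((x.comp (Equiv.swap j.castSucc j.succ)).comp i.succAbove)
        = - (((-1 : ℤ) ^ ((Equiv.swap j.castSucc j.succ i : Fin (n + 2)) : ℕ)) •
            oriented (x.comp (Equiv.swap j.castSucc j.succ i).succAbove)) := by
    intro i
    rw [hcomp]
    by_cases h1 : i = j.castSucc
    · subst h1
      rw [swap_comp_castSucc, Equiv.swap_apply_left, Fin.val_succ, Fin.val_castSucc, pow_succ]
      simp
    by_cases h2 : i = j.succ
    · subst h2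
      have : Equiv.swap j.castSucc j.succ ∘ j.succ.succAbove = j.castSucc.succAbove := by
        rw [← swap_comp_castSucc, ← Function.comp_assoc]
        funext k
        simp
      rw [this, Equiv.swap_apply_right, Fin.val_succ, Fin.val_castSucc, pow_succ]
      simp
    · obtain ⟨a, ha⟩ := Fin.exists_succAbove_eq (Ne.symm h1)
      obtain ⟨b, hb⟩ := Fin.exists_succAbove_eq (Ne.symm h2)
      have hab : a ≠ b := by
        rintro rfl
        exact hne (ha.symm.trans hb)
      rw [Equiv.swap_apply_of_ne_of_ne h1 h2, ← ha, ← hb, swap_comp_succAbove]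
      have : x.comp (i.succAbove ∘ Equiv.swap a b)
          = (x.comp i.succAbove).comp (Equiv.swap a b) := rfl
      rw [this, oriented_comp_perm, Equiv.Perm.sign_swap hab]
      simp
  unfold alternatingFaces
  rw [Finset.sum_congr rfl fun i _ => key i, Finset.sum_neg_distrib,
    Equiv.sum_comp (Equiv.swap j.castSucc j.succ)
      (fun i : Fin (n + 2) => ((-1 : ℤ) ^ (i : ℕ)) • oriented (x.comp i.succAbove))]

theorem alternatingFaces_perm {K : PreAbstractSimplicialComplex V} {n : ℕ}
    (x : Tuple K (n + 1)) (σ : Equiv.Perm (Fin (n + 2))) :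
    alternatingFaces (x.comp σ) = (Equiv.Perm.sign σ : ℤ) • alternatingFaces x := by
  have hσ : σ ∈ Submonoid.closure
      (Set.range fun i : Fin (n + 1) => Equiv.swap i.castSucc i.succ) := by
    rw [Equiv.Perm.mclosure_swap_castSucc_succ]
    trivial
  induction hσ using Submonoid.closure_induction generalizing x with
  | mem σ h =>
    obtain ⟨j, rfl⟩ := h
    simp only
    rw [alternatingFaces_swap, Equiv.Perm.sign_swap Fin.castSucc_lt_succ.ne]
    simp
  | one =>
    have : x.comp (1 : Equiv.Perm (Fin (n + 2))) = x := rfl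
    rw [this]
    simp
  | mul σ τ _ _ hs ht =>
    have : x.comp (σ * τ : Equiv.Perm (Fin (n + 2))) = (x.comp σ).comp τ := rfl
    rw [this, ht, hs, smul_smul, map_mul, mul_comm]
    simp

theorem alternatingFaces_of_not_injective {K : PreAbstractSimplicialComplex V} {n : ℕ}
    (x : Tuple K (n + 1)) (hx : ¬ Function.Injective x.1) : alternatingFaces x = 0 := by
  obtain ⟨a, b, hab, hne⟩ : ∃ a b, x.1 a = x.1 b ∧ a ≠ b := by
    simpa [Function.Injective] using hx
  obtain ⟨σ, h0, h1⟩ : ∃ σ : Equiv.Perm (Fin (n + 2)), σ 0 = a ∧ σ 1 = b := by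
    refine ⟨Equiv.swap 0 a * Equiv.swap 1 (Equiv.swap 0 a b), ?_, ?_⟩
    · have hb : (0 : Fin (n + 2)) ≠ Equiv.swap 0 a b := by
        intro h
        apply hne
        have := congrArg (Equiv.swap 0 a) h
        simpa using this
      rw [Equiv.Perm.mul_apply, Equiv.swap_apply_of_ne_of_ne (by simp) hb,
        Equiv.swap_apply_left]
    · simp
  have hy : alternatingFaces (x.comp σ) = 0 := by
    have h01 : (x.comp σ).1 0 = (x.comp σ).1 1 := by
      change x.1 (σ 0) = x.1 (σ 1)
      rw [h0, h1, hab]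
    generalize x.comp σ = y at h01
    unfold alternatingFaces
    rw [Fin.sum_univ_succ, Fin.sum_univ_succ]
    have hface : y.comp (Fin.succAbove 0) = y.comp (Fin.succAbove (Fin.succ 0)) := by
      apply Subtype.ext
      funext k
      change y.1 (Fin.succAbove 0 k) = y.1 (Fin.succAbove (Fin.succ 0) k)
      refine Fin.cases ?_ (fun k => ?_) k
      · simpa using h01.symm
      · simp
    rw [hface, Finset.sum_eq_zero]
    · simp
    · intro i _
      rw [oriented_of_not_injective, smul_zero]
      intro hinj
      have hi0 : (i.succ.succ : Fin (n + 2)) ≠ 0 := Fin.succ_ne_zero _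
      have hi1 : (i.succ.succ : Fin (n + 2)) ≠ 1 := by
        intro h
        exact Fin.succ_ne_zero i (Fin.succ_injective _ (h.trans Fin.succ_zero_eq_one.symm))
      obtain ⟨p, hp⟩ := Fin.exists_succAbove_eq hi0.symm
      obtain ⟨q, hq⟩ := Fin.exists_succAbove_eq hi1.symm
      have hpq : p = q := hinj (by
        change y.1 (Fin.succAbove _ p) = y.1 (Fin.succAbove _ q)
        rw [hp, hq, h01])
      rw [hpq, hq] at hp
      simp at hp
  have h := alternatingFaces_perm x σ
  rw [hy] at h
  rcases Int.units_eq_one_or (Equiv.Perm.sign σ) with h' | h' <;> rw [h'] at h <;> simpa using h.symm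

/-- The boundary operator
`∂ [v₀, …, vₙ₊₁] = ∑ i, (-1)^i [v₀, …, v̂ᵢ, …, vₙ₊₁]`. -/
noncomputable def boundary (K : PreAbstractSimplicialComplex V) (n : ℕ) :
    Chains K (n + 1) →ₗ[ℤ] Chains K n :=
  (orientationRelations K (n + 1)).liftQ
    (Finsupp.linearCombination ℤ fun x : Tuple K (n + 1) => alternatingFaces x) (by
      refine orientationRelations_le (fun x σ => ?_) (fun x hx => ?_)
      · simp [alternatingFaces_perm]
      · simp [alternatingFaces_of_not_injective x hx])

theorem boundary_oriented (K : PreAbstractSimplicialComplex V) (n : ℕ) (x : Tuple K (n + 1)) :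
    boundary K n (oriented x) = alternatingFaces x := by
  rw [boundary, oriented, Submodule.mkQ_apply, Submodule.liftQ_apply]
  simp

/-- The group of `n`-cycles; every `0`-chain is a cycle. -/
noncomputable def cycles (K : PreAbstractSimplicialComplex V) : (n : ℕ) → Submodule ℤ (Chains K n)
  | 0 => ⊤
  | n + 1 => LinearMap.ker (boundary K n)

/-- The group of `n`-boundaries. -/
noncomputable def boundaries (K : PreAbstractSimplicialComplex V) (n : ℕ) :
    Submodule ℤ (Chains K n) :=
  LinearMap.range (boundary K n)

/-- The integral simplicial homology group `Hₙ(K)`: cycles modulo boundaries. -/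
abbrev Homology (K : PreAbstractSimplicialComplex V) (n : ℕ) : Type _ :=
  cycles K n ⧸ (boundaries K n).submoduleOf (cycles K n)

noncomputable instance (K : PreAbstractSimplicialComplex V) (n : ℕ) :
    AddCommGroup (Homology K n) :=
  Submodule.Quotient.addCommGroup _

/-- A tuple of `K` as a tuple of a larger complex `L`. -/
def Tuple.incl {K L : PreAbstractSimplicialComplex V} (h : K ≤ L) {n : ℕ} (x : Tuple K n) :
    Tuple L n :=
  ⟨x.1, x.2.imp fun _ hs => ⟨h hs.1, hs.2⟩⟩

/-- The map on oriented chains induced by the inclusion of a subcomplex `K` of `L`. -/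
noncomputable def chainsIncl {K L : PreAbstractSimplicialComplex V} (h : K ≤ L) (n : ℕ) :
    Chains K n →ₗ[ℤ] Chains L n :=
  (orientationRelations K n).liftQ
    (Finsupp.linearCombination ℤ fun x : Tuple K n => oriented (x.incl h)) (by
      refine orientationRelations_le (fun x σ => ?_) (fun x hx => ?_)
      · have : oriented ((x.comp σ).incl h) = (Equiv.Perm.sign σ : ℤ) • oriented (x.incl h) :=
          oriented_comp_perm (x.incl h) σ
        simp [this]
      · simp [oriented_of_not_injective (x.incl h) hx])

theorem chainsIncl_oriented {K L : PreAbstractSimplicialComplex V} (h : K ≤ L) {n : ℕ}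
    (x : Tuple K n) : chainsIncl h n (oriented x) = oriented (x.incl h) := by
  simp [chainsIncl, oriented]

theorem chains_hom_ext {K : PreAbstractSimplicialComplex V} {n : ℕ} {M : Type*}
    [AddCommGroup M] {f g : Chains K n →ₗ[ℤ] M} (h : ∀ x, f (oriented x) = g (oriented x)) :
    f = g := by
  apply Submodule.linearMap_qext
  apply Finsupp.lhom_ext'
  intro x
  apply LinearMap.ext_ring
  exact h x

theorem boundary_comp_boundary (K : PreAbstractSimplicialComplex V) (n : ℕ) :
    boundary K n ∘ₗ boundary K (n + 1) = 0 := by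
  apply chains_hom_ext
  intro x
  have hinv : ∀ p : Fin (n + 3) × Fin (n + 2),
      ((-1 : ℤ) ^ ((p.1.succAbove p.2 : Fin (n + 3)) : ℕ) *
          (-1) ^ ((p.2.predAbove p.1 : Fin (n + 2)) : ℕ)) •
        oriented (x.comp ((p.1.succAbove p.2).succAbove ∘ (p.2.predAbove p.1).succAbove))
      = - (((-1 : ℤ) ^ (p.1 : ℕ) * (-1) ^ (p.2 : ℕ)) •
        oriented (x.comp (p.1.succAbove ∘ p.2.succAbove))) := by
    rintro ⟨i, j⟩
    have hcomp : (i.succAbove j).succAbove ∘ (j.predAbove i).succAbove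
        = i.succAbove ∘ j.succAbove := by
      funext k
      exact Fin.succAbove_succAbove_succAbove_predAbove i j k
    simp only
    rw [hcomp, ← pow_add, Fin.neg_one_pow_succAbove_add_predAbove, pow_add, neg_smul]
  have hsum : boundary K n (boundary K (n + 1) (oriented x))
      = ∑ p : Fin (n + 3) × Fin (n + 2), ((-1 : ℤ) ^ (p.1 : ℕ) * (-1) ^ (p.2 : ℕ)) •
        oriented (x.comp (p.1.succAbove ∘ p.2.succAbove)) := by
    rw [boundary_oriented, alternatingFaces, map_sum, Fintype.sum_prod_type]
    refine Finset.sum_congr rfl fun i _ => ?_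
    rw [map_smul, boundary_oriented, alternatingFaces, Finset.smul_sum]
    refine Finset.sum_congr rfl fun j _ => ?_
    rw [smul_smul]
    rfl
  rw [LinearMap.comp_apply, hsum, LinearMap.zero_apply]
  refine Finset.sum_involution
    (fun p _ => (p.1.succAbove p.2, p.2.predAbove p.1)) ?_ ?_ ?_ ?_
  · intro p _
    rw [hinv p, add_neg_cancel]
  · intro p _ _ h
    exact Fin.succAbove_ne p.1 p.2 (congrArg Prod.fst h)
  · intro p _
    exact Finset.mem_univ _
  · intro p _
    ext <;> simp [Fin.succAbove_succAbove_predAbove, Fin.predAbove_predAbove_succAbove]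

theorem boundary_comp_chainsIncl {K L : PreAbstractSimplicialComplex V} (h : K ≤ L) (n : ℕ) :
    boundary L n ∘ₗ chainsIncl h (n + 1) = chainsIncl h n ∘ₗ boundary K n := by
  apply chains_hom_ext
  intro x
  simp only [LinearMap.comp_apply, chainsIncl_oriented, boundary_oriented, alternatingFaces,
    map_sum, map_smul]
  rfl

theorem cycles_le_comap {K L : PreAbstractSimplicialComplex V} (h : K ≤ L) (n : ℕ) :
    cycles K n ≤ (cycles L n).comap (chainsIncl h n) := by
  cases n with
  | zero => exact fun _ _ => trivial
  | succ n =>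
    intro c hc
    have hc' : boundary K n c = 0 := hc
    have := LinearMap.congr_fun (boundary_comp_chainsIncl h n) c
    simp only [LinearMap.comp_apply, hc', map_zero] at this
    exact this

theorem boundaries_le_comap {K L : PreAbstractSimplicialComplex V} (h : K ≤ L) (n : ℕ) :
    boundaries K n ≤ (boundaries L n).comap (chainsIncl h n) := by
  rintro _ ⟨c, rfl⟩
  exact ⟨chainsIncl h (n + 1) c, LinearMap.congr_fun (boundary_comp_chainsIncl h n) c⟩

/-- The homomorphism `Hₙ(K) → Hₙ(L)` induced by the inclusion of a subcomplex `K` of `L`. -/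
noncomputable def homologyIncl {K L : PreAbstractSimplicialComplex V} (h : K ≤ L) (n : ℕ) :
    Homology K n →ₗ[ℤ] Homology L n :=
  Submodule.mapQ _ _ ((chainsIncl h n).restrict (cycles_le_comap h n))
    (fun _ hc => boundaries_le_comap h n hc)

end SimplicialHomology

/-! ## Point-neighbourhood homology of a partially ordered topological space -/

namespace PointNeighbourhood

variable {X : Type*} [TopologicalSpace X] [PartialOrder X]

/-- `(x, y)` is a topological edge if `x` and `y` have neighbourhoods `U`, `V` such that `s ≤ t`
for all `s ∈ U` and `t ∈ V`. -/
def IsTopologicalEdge (x y : X) : Prop :=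
  ∃ U ∈ 𝓝 x, ∃ V ∈ 𝓝 y, ∀ s ∈ U, ∀ t ∈ V, s ≤ t

/-- The undirected graph (loops and orientation forgotten) of the digraph of topological edges. -/
def edgeGraph (X : Type*) [TopologicalSpace X] [PartialOrder X] : SimpleGraph X :=
  SimpleGraph.fromRel IsTopologicalEdge

/-- The complex `Δ(F)`: its vertices are the points of `F`, and its simplices are the nonempty
finite subsets of `F` which are complete in the graph of topological edges. -/
def complex (F : Finset X) : PreAbstractSimplicialComplex X where
  faces := {s | s.Nonempty ∧ s ⊆ F ∧ (edgeGraph X).IsClique (s : Set X)}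
  isRelLowerSet_faces := fun _ hs =>
    ⟨hs.1, fun _ hts ht => ⟨ht, hts.trans hs.2.1, hs.2.2.subset (Finset.coe_subset.2 hts)⟩⟩

theorem complex_mono {F G : Finset X} (h : F ≤ G) : complex F ≤ complex G :=
  fun _ hs => ⟨hs.1, hs.2.1.trans h, hs.2.2⟩

open Classical in
/-- The point-neighbourhood homology `H_t(X)`: the direct limit of the groups `H_t(Δ(F))` over the
directed set of finite subsets `F` of `X`. -/
abbrev Homology (X : Type*) [TopologicalSpace X] [PartialOrder X] (t : ℕ) : Type _ :=
  Module.DirectLimit (R := ℤ) (fun F : Finset X => SimplicialHomology.Homology (complex F) t)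
    (fun _ _ h => SimplicialHomology.homologyIncl (complex_mono h) t)

end PointNeighbourhood

/-! ## Projection lattices, nest algebras and spectral homology

An orthogonal projection on a Hilbert space is represented by its range, a closed subspace; the
order `L₁ ≤ L₂ ↔ L₁ L₂ = L₁` becomes inclusion, and the identity operator becomes `⊤`. -/

namespace OperatorAlgebra

variable {H : Type*} [NormedAddCommGroup H] [InnerProductSpace ℂ H]

/-- `Lat A`, the lattice of closed subspaces invariant under every operator of `A`. -/
def lat (A : Subalgebra ℂ (H →L[ℂ] H)) : Set (ClosedSubmodule ℂ H) :=
  {M | ∀ T ∈ A, ∀ x ∈ M, T x ∈ M}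

/-- `Alg 𝓛`, the algebra of all bounded operators leaving every member of `𝓛` invariant. -/
def alg (𝓛 : Set (ClosedSubmodule ℂ H)) : Subalgebra ℂ (H →L[ℂ] H) where
  carrier := {T | ∀ M ∈ 𝓛, ∀ x ∈ M, T x ∈ M}
  mul_mem' hS hT M hM x hx := hS M hM _ (hT M hM x hx)
  add_mem' hS hT M hM x hx := add_mem (hS M hM x hx) (hT M hM x hx)
  algebraMap_mem' c M _ _ hx := M.toSubmodule.smul_mem c hx

/-- A nest: a totally ordered family of closed subspaces containing `0` and the whole space, and
closed under arbitrary intersections and closed linear spans. -/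
structure IsNest (𝒩 : Set (ClosedSubmodule ℂ H)) : Prop where
  isChain : IsChain (· ≤ ·) 𝒩
  bot_mem : ⊥ ∈ 𝒩
  top_mem : ⊤ ∈ 𝒩
  sInf_mem : ∀ S ⊆ 𝒩, sInf S ∈ 𝒩
  sSup_mem : ∀ S ⊆ 𝒩, sSup S ∈ 𝒩

/-- A nest algebra: the algebra of all operators leaving each member of some nest invariant. -/
def IsNestAlgebra (A : Subalgebra ℂ (H →L[ℂ] H)) : Prop :=
  ∃ 𝒩 : Set (ClosedSubmodule ℂ H), IsNest 𝒩 ∧ A = alg 𝒩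

/-- `M(𝓛)`: the meet-irreducible elements of the projection lattice `𝓛`, excluding the
identity. -/
def MeetIrreducibles (𝓛 : Set (ClosedSubmodule ℂ H)) : Type _ :=
  {M : ClosedSubmodule ℂ H //
    M ∈ 𝓛 ∧ M ≠ ⊤ ∧ ∀ E ∈ 𝓛, ∀ F ∈ 𝓛, E ⊓ F = M → E = M ∨ F = M}

instance (𝓛 : Set (ClosedSubmodule ℂ H)) : PartialOrder (MeetIrreducibles 𝓛) :=
  PartialOrder.lift (fun M => M.1) Subtype.val_injective

/-- The semi-interval `[L, I)` in `M(𝓛)`. -/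
def semiInterval (𝓛 : Set (ClosedSubmodule ℂ H)) (L : ClosedSubmodule ℂ H) :
    Set (MeetIrreducibles 𝓛) :=
  {M | L ≤ M.1}

/-- The topology of `M(𝓛)`, generated by the semi-intervals `[L, I)`, `L ∈ 𝓛`, and their
complements. -/
instance (𝓛 : Set (ClosedSubmodule ℂ H)) : TopologicalSpace (MeetIrreducibles 𝓛) :=
  TopologicalSpace.generateFrom
    {U | ∃ L ∈ 𝓛, U = semiInterval 𝓛 L ∨ U = (semiInterval 𝓛 L)ᶜ}

/-- The spectral homology group `H_t^{sp}(A)`: the point-neighbourhood homology of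
`M(Lat A)`. The definition only uses `Lat A`, so it is made for every algebra of operators; it is
of interest when `A` is reflexive with commutative, completely distributive `Lat A`. -/
abbrev SpectralHomology (A : Subalgebra ℂ (H →L[ℂ] H)) (t : ℕ) : Type _ :=
  PointNeighbourhood.Homology (MeetIrreducibles (lat A)) t

end OperatorAlgebra

/-! ## Homology of a cone -/

namespace SimplicialHomology

variable {V : Type*}

/-! A nest `𝒩` is reflexive: `lat (alg 𝒩) = 𝒩`, so the spectral homology is computed from a totally
ordered lattice. In a chain, if `x < y` then the clopen set `[y, I)` separates the two points:
everything outside it lies below `y`, hence below everything inside it. Thus any two distinct points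
are joined by a topological edge, and each nonempty `Δ(F)` is a full simplex. It is a cone over any
of its vertices, so its homology vanishes in positive degrees, and the direct limit of zero groups
is zero.

Reflexivity rests on rank one operators. If `N ∈ 𝒩`, `e ∈ N` and `f` is orthogonal to all members
strictly below `N`, then `z ↦ ⟪f, z⟫ e` is in the algebra (`rankOne_mem_alg`). Hence an invariant
`M` not contained in the span of those members contains every such `e`, that is, all of `N`
(`le_or_le_sSup_of_mem_lat`). This dichotomy, applied just above the largest member of the nest
inside `M`, leaves no room between that member and `M`. -/

/-- `K` is a cone with apex `v`: the vertex `v` can be joined to every simplex of `K`. -/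
def IsCone (K : PreAbstractSimplicialComplex V) (v : V) : Prop :=
  ∀ s ∈ K, ∃ t ∈ K, (t : Set V) = insert v (s : Set V)

/-- The tuple `(v, v₀, …, vₙ)`, where `v` is an apex of `K`. -/
def Tuple.cons {K : PreAbstractSimplicialComplex V} {v : V} (hv : IsCone K v) {n : ℕ}
    (x : Tuple K n) : Tuple K (n + 1) :=
  ⟨Fin.cons v x.1, by
    obtain ⟨s, hs, hsx⟩ := x.2
    obtain ⟨t, ht, hts⟩ := hv s hs
    exact ⟨t, ht, by rw [hts, hsx, Fin.range_cons]⟩⟩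

/-- `Equiv.Perm.decomposeFin.symm (0, σ)` fixes `0` and acts as `σ` on the remaining indices, so its
sign is that of `σ`. This is what makes the cone operator compatible with the orientation relations.
-/
theorem Tuple.cons_comp_perm {K : PreAbstractSimplicialComplex V} {v : V} (hv : IsCone K v)
    {n : ℕ} (x : Tuple K n) (σ : Equiv.Perm (Fin (n + 1))) :
    (x.comp σ).cons hv = (x.cons hv).comp (Equiv.Perm.decomposeFin.symm (0, σ)) := by
  apply Subtype.ext
  funext i
  refine Fin.cases ?_ (fun i => ?_) i <;> simp [Tuple.cons, Tuple.comp]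

/-- The cone operator `[v₀, …, vₙ] ↦ [v, v₀, …, vₙ]`. -/
noncomputable def coneMap {K : PreAbstractSimplicialComplex V} {v : V} (hv : IsCone K v)
    (n : ℕ) : Chains K n →ₗ[ℤ] Chains K (n + 1) :=
  (orientationRelations K n).liftQ
    (Finsupp.linearCombination ℤ fun x : Tuple K n => oriented (x.cons hv)) (by
      refine orientationRelations_le (fun x σ => ?_) (fun x hx => ?_)
      · simp [Tuple.cons_comp_perm, oriented_comp_perm]
      · have : ¬ Function.Injective (x.cons hv).1 := fun h =>
          hx (Fin.cons_injective_iff.1 h).2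
        simp [oriented_of_not_injective _ this])

theorem coneMap_oriented {K : PreAbstractSimplicialComplex V} {v : V} (hv : IsCone K v) {n : ℕ}
    (x : Tuple K n) : coneMap hv n (oriented x) = oriented (x.cons hv) := by
  simp [coneMap, oriented]

/-- The cone operator is a contracting homotopy: face `0` of `[v, v₀, …]` is the original simplex,
and each later face is the cone over a face of it, with the sign reversed by the index shift. The
identity is confined to degrees at least `1`; in degree `0` the face of `[v₀]` would be the empty
simplex. -/
theorem boundary_coneMap_add {K : PreAbstractSimplicialComplex V} {v : V} (hv : IsCone K v)
    (n : ℕ) :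
    boundary K (n + 1) ∘ₗ coneMap hv (n + 1) + coneMap hv n ∘ₗ boundary K n = LinearMap.id := by
  apply chains_hom_ext
  intro x
  have h0 : (x.cons hv).comp (Fin.succAbove 0) = x := by
    apply Subtype.ext
    funext k
    simp [Tuple.cons, Tuple.comp]
  have hs : ∀ i : Fin (n + 2),
      (x.cons hv).comp i.succ.succAbove = (x.comp i.succAbove).cons hv := by
    intro i
    apply Subtype.ext
    funext k
    refine Fin.cases ?_ (fun k => ?_) k <;> simp [Tuple.cons, Tuple.comp, Fin.removeNth]
  simp only [LinearMap.add_apply, LinearMap.comp_apply, LinearMap.id_apply, coneMap_oriented,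
    boundary_oriented, alternatingFaces, map_sum, map_smul]
  rw [Fin.sum_univ_succ, h0]
  simp only [hs, Fin.val_succ, pow_succ, Fin.val_zero, pow_zero, one_smul, mul_neg, mul_one,
    neg_smul, Finset.sum_neg_distrib]
  abel

/-- The homology of a cone vanishes in positive degrees. -/
theorem IsCone.subsingleton_homology {K : PreAbstractSimplicialComplex V} {v : V}
    (hv : IsCone K v) (n : ℕ) : Subsingleton (Homology K (n + 1)) := by
  rw [Submodule.Quotient.subsingleton_iff, eq_top_iff]
  rintro ⟨c, hc⟩ -
  have hc' : boundary K n c = 0 := hc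
  have h := LinearMap.congr_fun (boundary_coneMap_add hv n) c
  simp only [LinearMap.add_apply, LinearMap.comp_apply, hc', map_zero, add_zero,
    LinearMap.id_apply] at h
  exact ⟨coneMap hv (n + 1) c, h⟩

end SimplicialHomology

/-! ### Complete edge graphs -/

namespace PointNeighbourhood

variable {X : Type*} [TopologicalSpace X] [PartialOrder X]

theorem isCone_complex (hX : edgeGraph X = ⊤) {F : Finset X} {v : X} (hv : v ∈ F) :
    SimplicialHomology.IsCone (complex F) v := by
  classical
  rintro s ⟨-, hsF, -⟩
  refine ⟨insert v s, ⟨Finset.insert_nonempty v s, Finset.insert_subset hv hsF, ?_⟩,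
    Finset.coe_insert v s⟩
  rw [hX]
  exact fun _ _ _ _ h => h

/-- If any two distinct points are joined by a topological edge, then the point-neighbourhood
homology vanishes in positive degrees. -/
theorem subsingleton_homology_of_edgeGraph_eq_top (hX : edgeGraph X = ⊤) (n : ℕ) :
    Subsingleton (Homology X (n + 1)) := by
  classical
  refine subsingleton_of_forall_eq 0 fun z => ?_
  -- Every class in the limit is already represented over some finite `F`, so it suffices to kill
  -- each `H_{n+1}(Δ(F))`.
  obtain ⟨F, x, rfl⟩ := Module.DirectLimit.exists_of z
  have : Subsingleton (SimplicialHomology.Homology (complex F) (n + 1)) := by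
    rcases F.eq_empty_or_nonempty with rfl | ⟨v, hv⟩
    · have : IsEmpty (SimplicialHomology.Tuple (complex (∅ : Finset X)) (n + 1)) :=
        ⟨fun x => by
          obtain ⟨s, hs, -⟩ := x.2
          exact hs.1.ne_empty (Finset.subset_empty.1 hs.2.1)⟩
      infer_instance
    · exact (isCone_complex hX hv).subsingleton_homology n
  rw [Subsingleton.elim x 0, map_zero]

end PointNeighbourhood

/-! ## Reflexivity of nests -/

namespace OperatorAlgebra

variable {H : Type*} [NormedAddCommGroup H] [InnerProductSpace ℂ H]

/-- The rank one operator `z ↦ ⟪f, z⟫ e` belongs to the nest algebra if `e` lies in a member `N`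
of the nest and `f` is orthogonal to the members strictly below `N`. -/
theorem rankOne_mem_alg {𝒩 : Set (ClosedSubmodule ℂ H)} (h𝒩 : IsChain (· ≤ ·) 𝒩)
    {N : ClosedSubmodule ℂ H} (hN : N ∈ 𝒩) {e f : H} (he : e ∈ N)
    (hf : ∀ L ∈ 𝒩, L < N → ∀ z ∈ L, inner ℂ f z = 0) :
    InnerProductSpace.rankOne ℂ e f ∈ alg 𝒩 := by
  intro L hL z hz
  rw [InnerProductSpace.rankOne_apply]
  -- Either `L` contains `N`, hence the range of the operator, or `L` lies strictly below `N` and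
  -- the operator annihilates it.
  by_cases hNL : N ≤ L
  · exact L.toSubmodule.smul_mem _ (hNL he)
  · have hLN : L < N := lt_of_le_not_ge ((h𝒩.total hN hL).resolve_left hNL) hNL
    rw [hf L hL hLN z hz, zero_smul]
    exact zero_mem L

/-- An invariant subspace of a nest algebra either contains the member `N` of the nest or is
contained in the closed span of the members strictly below `N`. -/
theorem le_or_le_sSup_of_mem_lat [CompleteSpace H] {𝒩 : Set (ClosedSubmodule ℂ H)}
    (h𝒩 : IsChain (· ≤ ·) 𝒩) {M : ClosedSubmodule ℂ H} (hM : M ∈ lat (alg 𝒩))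
    {N : ClosedSubmodule ℂ H} (hN : N ∈ 𝒩) :
    N ≤ M ∨ M ≤ sSup {L ∈ 𝒩 | L < N} := by
  set P := sSup {L ∈ 𝒩 | L < N} with hP
  refine or_iff_not_imp_right.2 fun hMP e he => ?_
  obtain ⟨x, hxM, hxP⟩ : ∃ x ∈ M, x ∉ P := by
    by_contra! h
    exact hMP fun x hx => h x hx
  have : CompleteSpace P.toSubmodule := P.isClosed.completeSpace_coe
  -- Since `P` is closed, `Pᗮᗮ = P`, so a vector outside `P` is detected by some `f ∈ Pᗮ`. The rank
  -- one operator built from `e` and `f` then sends `x` to a nonzero multiple of `e`.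
  obtain ⟨f, hf, hfx⟩ : ∃ f ∈ P.toSubmoduleᗮ, inner ℂ f x ≠ 0 := by
    by_contra! h
    apply hxP
    have hx : x ∈ P.toSubmoduleᗮᗮ := fun f hf => h f hf
    rwa [Submodule.orthogonal_orthogonal] at hx
  have hT := rankOne_mem_alg h𝒩 hN he (f := f) fun L hL hLN z hz =>
    Submodule.inner_left_of_mem_orthogonal
      (le_sSup (show L ∈ {L ∈ 𝒩 | L < N} from ⟨hL, hLN⟩) hz : z ∈ P) hf
  have := M.toSubmodule.smul_mem (inner ℂ f x)⁻¹ (hM _ hT x hxM)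
  rwa [InnerProductSpace.rankOne_apply, smul_smul, inv_mul_cancel₀ hfx, one_smul] at this

/-- Every nest is reflexive. -/
theorem IsNest.lat_alg [CompleteSpace H] {𝒩 : Set (ClosedSubmodule ℂ H)} (h𝒩 : IsNest 𝒩) :
    lat (alg 𝒩) = 𝒩 := by
  refine Set.Subset.antisymm (fun M hM => ?_) fun M hM T hT => hT M hM
  -- `K` is the largest member of the nest contained in `M`; the aim is `M = K`.
  set K := sSup {N ∈ 𝒩 | N ≤ M} with hK
  have hK𝒩 : K ∈ 𝒩 := h𝒩.sSup_mem _ fun _ h => h.1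
  have hKM : K ≤ M := sSup_le fun _ h => h.2
  have below : ∀ N ∈ 𝒩, K < N → M ≤ sSup {L ∈ 𝒩 | L < N} := fun N hN hKN =>
    (le_or_le_sSup_of_mem_lat h𝒩.isChain hM hN).resolve_left fun h =>
      hKN.not_ge (le_sSup ⟨hN, h⟩)
  -- `J` is the immediate successor of `K` if there is one, and otherwise `K` itself. For `K = ⊤`
  -- the infimum is over the empty set, giving `J = ⊤ = K`.
  set J := sInf {N ∈ 𝒩 | K < N} with hJ
  have hJ𝒩 : J ∈ 𝒩 := h𝒩.sInf_mem _ fun _ h => h.1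
  have hMK : M ≤ K := by
    rcases (le_sInf fun N hN => hN.2.le : K ≤ J).lt_or_eq with hKJ | hKJ
    -- Gap above `K`: every member strictly below `J` is at most `K`, so the span bounding `M` is
    -- inside `K`.
    · refine (below J hJ𝒩 hKJ).trans (sSup_le fun L hL => ?_)
      refine (h𝒩.isChain.total hL.1 hK𝒩).elim id fun hKL => ?_
      rcases hKL.lt_or_eq with h | h
      · exact absurd (sInf_le ⟨hL.1, h⟩ : J ≤ L) hL.2.not_ge
      · exact h.ge
    -- No gap: `M` lies below every member strictly above `K`, and these have infimum `K`.
    · rw [hKJ]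
      exact le_sInf fun N hN => (below N hN.1 hN.2).trans (sSup_le fun L hL => hL.2.le)
  rwa [← hKM.antisymm hMK]

/-! ### Topological edges in a totally ordered lattice -/

/-- If the projection lattice is totally ordered, then any two distinct meet-irreducible elements
are joined by a topological edge. -/
theorem edgeGraph_eq_top {𝓛 : Set (ClosedSubmodule ℂ H)} (h𝓛 : IsChain (· ≤ ·) 𝓛) :
    PointNeighbourhood.edgeGraph (MeetIrreducibles 𝓛) = ⊤ := by
  have hopen : ∀ U : Set (MeetIrreducibles 𝓛),
      (∃ L ∈ 𝓛, U = semiInterval 𝓛 L ∨ U = (semiInterval 𝓛 L)ᶜ) → IsOpen U :=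
    fun U hU => TopologicalSpace.isOpen_generateFrom_of_mem hU
  have key : ∀ x y : MeetIrreducibles 𝓛, x ≠ y → x ≤ y →
      PointNeighbourhood.IsTopologicalEdge x y := by
    intro x y hne hxy
    have hlt : ¬ y.1 ≤ x.1 := fun h => hne (le_antisymm hxy h)
    -- One semi-interval gives both neighbourhoods: `s` outside `[y, I)` satisfies `s ≤ y` by
    -- totality, and `t` inside satisfies `y ≤ t`.
    refine ⟨(semiInterval 𝓛 y.1)ᶜ,
      (hopen _ ⟨y.1, y.2.1, Or.inr rfl⟩).mem_nhds hlt,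
      semiInterval 𝓛 y.1,
      (hopen _ ⟨y.1, y.2.1, Or.inl rfl⟩).mem_nhds
        (le_refl y.1), fun s hs t ht => ?_⟩
    exact le_trans ((h𝓛.total s.2.1 y.2.1).resolve_right hs) ht
  ext x y
  rw [PointNeighbourhood.edgeGraph, SimpleGraph.fromRel_adj, SimpleGraph.top_adj]
  refine ⟨fun h => h.1, fun hne => ⟨hne, ?_⟩⟩
  exact (h𝓛.total x.2.1 y.2.1).imp (key x y hne) (key y x hne.symm)

end OperatorAlgebra

/-- The spectral homology of a nest algebra acting on a separable complex Hilbert space vanishes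
in every positive degree. -/
theorem proposition3p4 {H : Type*} [NormedAddCommGroup H] [InnerProductSpace ℂ H]
    [CompleteSpace H] [TopologicalSpace.SeparableSpace H]
    (A : Subalgebra ℂ (H →L[ℂ] H)) (hA : OperatorAlgebra.IsNestAlgebra A)
    (t : ℕ) (ht : 0 < t) :
    Subsingleton (OperatorAlgebra.SpectralHomology A t) := by
  obtain ⟨𝒩, h𝒩, rfl⟩ := hA
  obtain ⟨n, rfl⟩ := Nat.exists_eq_succ_of_ne_zero ht.ne'
  apply PointNeighbourhood.subsingleton_homology_of_edgeGraph_eq_top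
  apply OperatorAlgebra.edgeGraph_eq_top
  rw [h𝒩.lat_alg]
  exact h𝒩.isChain
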